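/- Consider a fully connected feedforward neural network with layers $0,\dots,L$ having $m_0,\dots,m_L$ nodes, weights $w^{(l)}_{ja}$ (from node $j$ of layer $l$ to node $a$ of layer $l+1$), biases $b^{(l)}_a$ and activation maps $f^{(l)}:\mathbb R^{m_{l+1}}\to\mathbb R^{m_{l+1}}$, $0\le l<L$ (acting node by node, or jointly as softmax does). For an input $x\in\mathbb R^{m_0}$ and a noise vector $e=(e^{(l)}_{ja})$ with one entry per connection, put $X^{(0)}=x$ and $$X^{(l+1)}=f^{(l)}\big(u^{(l+1)}\big),\qquad u^{(l+1)}_a=b^{(l)}_a+\sum_{j}w^{(l)}_{ja}\big(X^{(l)}_j+e^{(l)}_{ja}\big),$$ and let $f(x,e\mid w,b)=X^{(L)}$ be the output of the perturbed network. For $n\ge1$ training cases $(x_i,y_i)$ and $k\ge 1$ epochs, the noise perturbed empirical loss function (pelf) is $$l_p(w,b\mid x,y,e)=\frac1{kn}\sum_{j=1}^{k}\sum_{i=1}^{n}\big\|f(x_i,e_{ij}\mid w,b)-y_i\big\|^2,$$ a function of the collective noise $e=(e_{ij})_{i\le n,\,j\le k}$, where $\|\cdot\|$ is the Euclidean norm.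 (Additive) Gaussian whiteout noise with tuning parameters $\sigma^2\ge0$, $\lambda\ge0$, $\gamma\in(0,2)$ means that all entries of $e$ are independent and the entry of $e_{ij}$ on a connection of weight $w$ has law $N(0,\sigma^2|w|^{-\gamma}+\lambda)$ (for $w=0$ read $|w|^{-\gamma}$ as $0$; this is immaterial, since that entry is multiplied by $w=0$). Assume that the activations $f^{(l)}$ are Lipschitz continuous, that the weights are bounded, $|w^{(l)}_{ja}|\le R$, that the outputs are bounded, $\|y_i\|\le C$ for all $i$, and that the loss is uniformly bounded, $\|f(x_i,e\mid w,b)-y_i\|^2\le M$ for all $i$ and all noise vectors $e$. Then there is a constant $B>0$, depending only on the layer sizes, the activations, $\sigma,\gamma,\lambda,R,C$ and $M$ (in particular not on $n$, $k$, $\delta$, the data, or the particular weights and biases), such that $e\mapsto l_p(w,b\mid x,y,e)$ is $B/\sqrt{kn}$-Lipschitz with respect to the Euclidean norm and, when $e$ is Gaussian whiteout noise, $l_p(w,b\mid x,y,e)$ is integrable and for every $\delta>0$ $$\Pr\Big(\big|l_p(w,b\mid x,y,e)-\mathrm E_e\, l_p(w,b\mid x,y,e)\big|>\delta\Big)\le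 2\exp\Big(-\frac{kn\,\delta^2}{2B^2}\Big).$$ -/

import Mathlib

open MeasureTheory ProbabilityTheory
open scoped NNReal

noncomputable section

namespace Whiteout

/-- The connections of a fully connected feedforward network whose layers are numbered
`0, …, L` (layer `0` is the input, layer `L` the output) and have `m 0, …, m L` nodes: a
triple `⟨l, j, k⟩` is the connection from node `j` of layer `l` to node `k` of layer `l + 1`.
Noise is injected on every connection, that is, into the input and all hidden layers. -/
abbrev Edge {L : ℕ} (m : Fin (L + 1) → ℕ) : Type :=
  Σ l : Fin L, Fin (m l.castSucc) × Fin (m l.succ)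

/-- The space of values of a layer with `d` nodes, with the Euclidean norm. -/
abbrev Nodes (d : ℕ) : Type := EuclideanSpace ℝ (Fin d)

/-- Weights: `w l j k` is the weight of the connection `⟨l, j, k⟩`. -/
abbrev Weights {L : ℕ} (m : Fin (L + 1) → ℕ) : Type :=
  ∀ l : Fin L, Matrix (Fin (m l.castSucc)) (Fin (m l.succ)) ℝ

/-- Biases: `b l k` is the bias of node `k` of layer `l + 1`. -/
abbrev Biases {L : ℕ} (m : Fin (L + 1) → ℕ) : Type :=
  ∀ l : Fin L, Fin (m l.succ) → ℝ

/-- Activations: `act l` maps the pre-activations of layer `l + 1` to its node values. It may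
act on every node separately (sigmoid, tanh, …) or jointly (softmax). -/
abbrev Activations {L : ℕ} (m : Fin (L + 1) → ℕ) : Type :=
  ∀ l : Fin L, Nodes (m l.succ) → Nodes (m l.succ)

/-- Values of the layers of the noise-perturbed network on the input `x`: the signal sent from
node `j` of layer `l` to node `k` of the next layer is perturbed to `X j + e ⟨l, j, k⟩`. -/
def layer {L : ℕ} {m : Fin (L + 1) → ℕ} (act : Activations m) (w : Weights m) (b : Biases m)
    (x : Nodes (m 0)) (e : Edge m → ℝ) (l : Fin (L + 1)) : Nodes (m l) :=
  Fin.induction (motive := fun l => Nodes (m l)) x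
    (fun l X => act l (WithLp.toLp 2 fun k => b l k + ∑ j, w l j k * (X j + e ⟨l, j, k⟩))) l

/-- The output of the noise-perturbed network. -/
def output {L : ℕ} {m : Fin (L + 1) → ℕ} (act : Activations m) (w : Weights m) (b : Biases m)
    (x : Nodes (m 0)) (e : Edge m → ℝ) : Nodes (m (Fin.last L)) :=
  layer act w b x e (Fin.last L)

/-- The collective noise: one real number for each training case `i`, epoch `j` and connection,
with the Euclidean norm. -/
abbrev Noise {L : ℕ} (m : Fin (L + 1) → ℕ) (n k : ℕ) : Type :=
  EuclideanSpace ℝ (Fin n × Fin k × Edge m)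

/-- The noise perturbed empirical loss function with `n` training cases and `k` epochs. -/
def pelf {L : ℕ} {m : Fin (L + 1) → ℕ} (act : Activations m) (w : Weights m) (b : Biases m)
    {n : ℕ} (k : ℕ) (x : Fin n → Nodes (m 0)) (y : Fin n → Nodes (m (Fin.last L)))
    (e : Noise m n k) : ℝ :=
  ((k : ℝ) * n)⁻¹ * ∑ j : Fin k, ∑ i : Fin n,
    ‖output act w b (x i) (fun a => e (i, j, a)) - y i‖ ^ 2

/-- The variance `σ² |w|^(-γ) + lam` of the whiteout noise on a connection of weight `w`.
For `w = 0` the power is read as `0`; any other reading gives the same perturbed network,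
as the noise on that connection is multiplied by the weight `0`. -/
def noiseVar (σ γ lam w : ℝ) : ℝ≥0 :=
  Real.toNNReal (σ ^ 2 * |w| ^ (-γ) + lam)

/-- `e` is Gaussian whiteout noise: independent centred Gaussian variables with variances given
by the weights. -/
structure IsWhiteoutNoise {L : ℕ} {m : Fin (L + 1) → ℕ} (σ γ lam : ℝ) (w : Weights m) {n k : ℕ}
    {Ω : Type*} [MeasurableSpace Ω] (μ : Measure Ω) (e : Ω → Noise m n k) : Prop where
  indep : iIndepFun (fun (a : Fin n × Fin k × Edge m) ω => e ω a) μ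
  law : ∀ (i : Fin n) (j : Fin k) (a : Edge m),
    HasLaw (fun ω => e ω (i, j, a)) (gaussianReal 0 (noiseVar σ γ lam (w a.1 a.2.1 a.2.2))) μ

end Whiteout

end

namespace Whiteout

/-! The pelf is the mean of $kn$ losses, one for each pair of a training case and an epoch, and each
loss depends only on its own block of the noise.

Lipschitz bound: by induction on the layers, the output is Lipschitz in a block, uniformly over
bounded weights (`exists_norm_layer_sub_le`). Squaring a bounded distance keeps this
(`abs_norm_sub_sq_sub_le`), and Cauchy–Schwarz over the blocks (`sum_norm_block_le`) turns $1/(kn)$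
into $1/\sqrt{kn}$.

Tail bound: the blocks are independent (`iIndepFun_curry`) and the losses lie in $[0, M]$, so
Hoeffding's inequality applies. Gaussian concentration is avoided: the variance
$\sigma^2|w|^{-\gamma}+\lambda$ can blow up as $w \to 0$, so it would not directly give a constant
uniform in the weights. -/

/-- If all entries of a doubly indexed family of random variables are independent, then so are
its rows. -/
lemma iIndepFun_curry {ι κ Ω β : Type*} [Countable ι] [Countable κ] [MeasurableSpace Ω]
    [MeasurableSpace β] {μ : Measure Ω} [IsProbabilityMeasure μ] {X : ι → κ → Ω → β}
    (hX : ∀ i j, AEMeasurable (X i j) μ) (h : iIndepFun (fun (p : ι × κ) ω => X p.1 p.2 ω) μ) :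
    iIndepFun (fun i ω j => X i j ω) μ := by
  have hrow : ∀ i, AEMeasurable (fun ω j => X i j ω) μ := fun i => aemeasurable_pi_iff.2 (hX i)
  have hall : AEMeasurable (fun ω (p : ι × κ) => X p.1 p.2 ω) μ :=
    aemeasurable_pi_iff.2 fun p => hX p.1 p.2
  have : ∀ i j, IsProbabilityMeasure (μ.map (X i j)) :=
    fun i j => Measure.isProbabilityMeasure_map (hX i j)
  have hi : ∀ i, μ.map (fun ω j => X i j ω) = Measure.infinitePi (fun j => μ.map (X i j)) :=
    fun i => (h.precomp (g := fun j => (i, j))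
      (Prod.mk_right_injective i)).map_fun_eq_infinitePi_map₀ (hrow i)
  -- Independence means that the joint law is a product; currying turns the product over pairs into
  -- a product of the row laws.
  rw [iIndepFun_iff_map_fun_eq_infinitePi_map₀' hrow]
  have hcomp : (fun ω i j => X i j ω)
      = MeasurableEquiv.curry ι κ β ∘ fun ω (p : ι × κ) => X p.1 p.2 ω := rfl
  rw [hcomp, ← AEMeasurable.map_map_of_aemeasurable
    (MeasurableEquiv.curry ι κ β).measurable.aemeasurable hall, h.map_fun_eq_infinitePi_map₀ hall]
  simp_rw [hi]
  exact Measure.infinitePi_map_curry (fun i j => μ.map (X i j))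

/-- **Hoeffding's inequality**, two-sided, for the mean of independent random variables with
values in `[0, 2 * B]`. -/
lemma measureReal_lt_abs_mean_sub_le {ι Ω : Type*} [Fintype ι] [Nonempty ι] [MeasurableSpace Ω]
    {μ : Measure Ω} [IsProbabilityMeasure μ] {Z : ι → Ω → ℝ} {B : ℝ} (hB : 0 < B)
    (hZ : ∀ i, AEMeasurable (Z i) μ) (hZB : ∀ i ω, Z i ω ∈ Set.Icc 0 (2 * B))
    (hind : iIndepFun Z μ) {δ : ℝ} (hδ : 0 < δ) :
    μ.real {ω | δ < |(Fintype.card ι : ℝ)⁻¹ * ∑ i, Z i ω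
        - ∫ ω', (Fintype.card ι : ℝ)⁻¹ * ∑ i, Z i ω' ∂μ|}
      ≤ 2 * Real.exp (-(Fintype.card ι * δ ^ 2 / (2 * B ^ 2))) := by
  set N : ℝ := (Fintype.card ι : ℝ) with hN
  have hN0 : 0 < N := by rw [hN]; exact_mod_cast Fintype.card_pos
  have hint : ∀ i, Integrable (Z i) μ := fun i =>
    Integrable.of_mem_Icc 0 (2 * B) (hZ i) (.of_forall (hZB i))
  -- The variance proxy in Hoeffding's lemma: the squared half-length of the interval.
  let c : ℝ≥0 := (‖2 * B - 0‖₊ / 2) ^ 2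
  have hc : (c : ℝ) = B ^ 2 := by simp [c, abs_of_pos hB]
  have hcentred : iIndepFun (fun i ω => Z i ω - μ[Z i]) μ :=
    hind.comp (fun i z => (z - ∫ ω, Z i ω ∂μ : ℝ)) fun i => measurable_id.sub_const _
  have hsub : HasSubgaussianMGF (fun ω => ∑ i, (Z i ω - μ[Z i])) (∑ _i : ι, c) μ :=
    HasSubgaussianMGF.sum_of_iIndepFun hcentred (c := fun _ => c)
      fun i _ => hasSubgaussianMGF_of_mem_Icc (hZ i) (.of_forall (hZB i))
  have hexp : -(N * δ) ^ 2 / (2 * ((∑ _i : ι, c : ℝ≥0) : ℝ)) = -(N * δ ^ 2 / (2 * B ^ 2)) := by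
    rw [Finset.sum_const, Finset.card_univ, nsmul_eq_mul, NNReal.coe_mul, hc, NNReal.coe_natCast,
      ← hN]
    field_simp
  have hε : 0 ≤ N * δ := by positivity
  have hup := hsub.measure_ge_le hε
  have hlow := hsub.neg.measure_ge_le hε
  rw [hexp] at hup hlow
  have hdev : ∀ ω, N⁻¹ * ∑ i, Z i ω - ∫ ω', N⁻¹ * ∑ i, Z i ω' ∂μ
      = N⁻¹ * ∑ i, (Z i ω - μ[Z i]) := by
    intro ω
    rw [integral_const_mul, integral_finsetSum _ fun i _ => hint i, Finset.sum_sub_distrib]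
    ring
  calc _ ≤ μ.real ({ω | N * δ ≤ ∑ i, (Z i ω - μ[Z i])}
        ∪ {ω | N * δ ≤ (-fun ω => ∑ i, (Z i ω - μ[Z i])) ω}) := by
        refine measureReal_mono fun ω hω => ?_
        rw [Set.mem_ofPred_eq, hdev, abs_mul, abs_of_pos (inv_pos.2 hN0), inv_mul_eq_div,
          lt_div_iff₀ hN0, mul_comm, lt_abs] at hω
        exact hω.imp le_of_lt le_of_lt
    _ ≤ _ := (measureReal_union_le _ _).trans (by linarith)

lemma norm_toLp_le_sum_abs {d : ℕ} (v : Fin d → ℝ) :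
    ‖(WithLp.toLp 2 v : Nodes d)‖ ≤ ∑ k, |v k| := by
  rw [EuclideanSpace.norm_eq]
  refine Real.sqrt_le_iff.2 ⟨by positivity, ?_⟩
  simpa using Finset.sum_sq_le_sq_sum_of_nonneg (s := Finset.univ) (f := fun k => |v k|)
    fun _ _ => abs_nonneg _

variable {L : ℕ} {m : Fin (L + 1) → ℕ}

lemma layer_succ (act : Activations m) (w : Weights m) (b : Biases m) (x : Nodes (m 0))
    (e : Edge m → ℝ) (l : Fin L) :
    layer act w b x e l.succ = act l (WithLp.toLp 2 fun k =>
      b l k + ∑ j, w l j k * (layer act w b x e l.castSucc j + e ⟨l, j, k⟩)) :=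
  Fin.induction_succ ..

/-- Each layer is Lipschitz in the noise, uniformly over bounded weights. -/
lemma exists_norm_layer_sub_le {act : Activations m}
    (hact : ∀ l, ∃ K : ℝ≥0, LipschitzWith K (act l)) {R : ℝ} (hR : 0 ≤ R) (l : Fin (L + 1)) :
    ∃ K : ℝ, 0 ≤ K ∧ ∀ (w : Weights m) (b : Biases m) (x : Nodes (m 0)),
      (∀ l j k, |w l j k| ≤ R) → ∀ e e' : Edge m → ℝ,
        ‖layer act w b x e l - layer act w b x e' l‖ ≤ K * ‖e - e'‖ := by
  induction l using Fin.induction with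
  | zero => exact ⟨0, le_rfl, fun w b x _ e e' => by simp [layer]⟩
  | succ l ih =>
    obtain ⟨K, hK0, hK⟩ := ih
    obtain ⟨A, hA⟩ := hact l
    -- Each connection contributes at most `R * (K + 1)`: `K` from the previous layer, `1` from its
    -- own noise. The other factors count the connections and apply the activation.
    refine ⟨A * (m l.succ * (m l.castSucc * (R * (K + 1)))), by positivity,
      fun w b x hw e e' => ?_⟩
    rw [layer_succ, layer_succ, mul_assoc]
    refine (hA.norm_sub_le _ _).trans (mul_le_mul_of_nonneg_left ?_ A.2)
    rw [← WithLp.toLp_sub]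
    refine (norm_toLp_le_sum_abs _).trans ?_
    have hk : ∀ k j, |w l j k * (layer act w b x e l.castSucc j + e ⟨l, j, k⟩)
        - w l j k * (layer act w b x e' l.castSucc j + e' ⟨l, j, k⟩)|
          ≤ R * (K + 1) * ‖e - e'‖ := by
      intro k j
      have h1 : |layer act w b x e l.castSucc j - layer act w b x e' l.castSucc j|
          ≤ K * ‖e - e'‖ :=
        (PiLp.norm_apply_le (layer act w b x e l.castSucc - layer act w b x e' l.castSucc) j).trans
          (hK w b x hw e e')
      have h2 : |e ⟨l, j, k⟩ - e' ⟨l, j, k⟩| ≤ ‖e - e'‖ := norm_le_pi_norm (e - e') ⟨l, j, k⟩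
      rw [← mul_sub, abs_mul, add_sub_add_comm, mul_assoc]
      exact mul_le_mul (hw l j k) ((abs_add_le _ _).trans (by linarith)) (abs_nonneg _) hR
    have hsum : ∀ k ∈ Finset.univ, |((fun k => b l k
          + ∑ j, w l j k * (layer act w b x e l.castSucc j + e ⟨l, j, k⟩)) - fun k => b l k
          + ∑ j, w l j k * (layer act w b x e' l.castSucc j + e' ⟨l, j, k⟩)) k|
        ≤ m l.castSucc * (R * (K + 1) * ‖e - e'‖) := by
      intro k _
      rw [Pi.sub_apply, add_sub_add_left_eq_sub, ← Finset.sum_sub_distrib]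
      refine (Finset.abs_sum_le_sum_abs _ _).trans
        ((Finset.sum_le_card_nsmul _ _ _ fun j _ => hk k j).trans ?_)
      simp
    refine (Finset.sum_le_card_nsmul _ _ _ hsum).trans (le_of_eq ?_)
    simp only [Finset.card_univ, Fintype.card_fin, nsmul_eq_mul]
    ring

/-- The pelf as the mean of the losses over all pairs of a training case and an epoch. -/
lemma pelf_eq_mean (act : Activations m) (w : Weights m) (b : Biases m) {n k : ℕ}
    (x : Fin n → Nodes (m 0)) (y : Fin n → Nodes (m (Fin.last L))) (e : Noise m n k) :
    pelf act w b k x y e = (Fintype.card (Fin n × Fin k) : ℝ)⁻¹ *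
      ∑ p : Fin n × Fin k, ‖output act w b (x p.1) (fun a => e (p.1, p.2, a)) - y p.1‖ ^ 2 := by
  rw [pelf, Finset.sum_comm, Fintype.sum_prod_type, Fintype.card_prod, Fintype.card_fin,
    Fintype.card_fin, Nat.cast_mul, mul_comm (k : ℝ)]

/-- If the squared distances of `u` and `v` to `y` are at most `M`, they differ by at most
`2 * √M * ‖u - v‖`. -/
lemma abs_norm_sub_sq_sub_le {E : Type*} [SeminormedAddCommGroup E] {u v y : E} {M : ℝ}
    (hu : ‖u - y‖ ^ 2 ≤ M) (hv : ‖v - y‖ ^ 2 ≤ M) :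
    |‖u - y‖ ^ 2 - ‖v - y‖ ^ 2| ≤ 2 * √M * ‖u - v‖ := by
  have h : |‖u - y‖ - ‖v - y‖| ≤ ‖u - v‖ := by
    simpa using abs_norm_sub_norm_le (u - y) (v - y)
  rw [sq_sub_sq, abs_mul, abs_of_nonneg (by positivity)]
  exact mul_le_mul (by linarith [Real.le_sqrt_of_sq_le hu, Real.le_sqrt_of_sq_le hv]) h
    (abs_nonneg _) (by positivity)

/-- The sum of the sup norms of the blocks of a vector is at most the Euclidean norm times the
square root of the number of blocks. -/
lemma sum_norm_block_le {n k : ℕ} (v : Noise m n k) :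
    ∑ p : Fin n × Fin k, ‖fun a : Edge m => v (p.1, p.2, a)‖ ≤ √((k : ℝ) * n) * ‖v‖ := by
  have hblock : ∀ p : Fin n × Fin k,
      ‖fun a : Edge m => v (p.1, p.2, a)‖ ^ 2 ≤ ∑ a : Edge m, v (p.1, p.2, a) ^ 2 := by
    intro p
    refine (Real.le_sqrt (norm_nonneg _) (by positivity)).1 ?_
    refine (pi_norm_le_iff_of_nonneg (Real.sqrt_nonneg _)).2 fun a => Real.abs_le_sqrt ?_
    exact Finset.single_le_sum (f := fun a : Edge m => v (p.1, p.2, a) ^ 2)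
      (fun _ _ => sq_nonneg _) (Finset.mem_univ a)
  rw [EuclideanSpace.norm_eq, ← Real.sqrt_mul (by positivity)]
  -- Cauchy–Schwarz over the blocks.
  refine Real.le_sqrt_of_sq_le (sq_sum_le_card_mul_sum_sq.trans ?_)
  rw [Finset.card_univ, Fintype.card_prod, Fintype.card_fin, Fintype.card_fin, Nat.cast_mul,
    mul_comm (n : ℝ)]
  refine mul_le_mul_of_nonneg_left ((Finset.sum_le_sum fun p _ => hblock p).trans_eq ?_)
    (by positivity)
  simp_rw [Real.norm_eq_abs, sq_abs, Fintype.sum_prod_type]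

end Whiteout

theorem corollary3 {L : ℕ} (m : Fin (L + 1) → ℕ) (act : Whiteout.Activations m)
    (hact : ∀ l, ∃ K : ℝ≥0, LipschitzWith K (act l))
    (σ γ lam : ℝ) (hγ : γ ∈ Set.Ioo (0 : ℝ) 2) (hlam : 0 ≤ lam)
    (R Cy M : ℝ) :
    ∃ B : ℝ, 0 < B ∧
      ∀ (n k : ℕ), 0 < n → 0 < k →
      ∀ (x : Fin n → Whiteout.Nodes (m 0)) (y : Fin n → Whiteout.Nodes (m (Fin.last L)))
        (w : Whiteout.Weights m) (b : Whiteout.Biases m),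
      (∀ l j k', |w l j k'| ≤ R) →
      (∀ i, ‖y i‖ ≤ Cy) →
      (∀ i (e : Whiteout.Edge m → ℝ), ‖Whiteout.output act w b (x i) e - y i‖ ^ 2 ≤ M) →
      LipschitzWith (Real.toNNReal (B / √((k : ℝ) * n))) (Whiteout.pelf act w b k x y) ∧
      ∀ {Ω : Type*} [MeasurableSpace Ω] (μ : Measure Ω) [IsProbabilityMeasure μ]
        (e : Ω → Whiteout.Noise m n k), Whiteout.IsWhiteoutNoise σ γ lam w μ e →
        Integrable (fun ω => Whiteout.pelf act w b k x y (e ω)) μ ∧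
        ∀ δ : ℝ, 0 < δ →
          μ.real {ω | δ < |Whiteout.pelf act w b k x y (e ω)
              - ∫ ω', Whiteout.pelf act w b k x y (e ω') ∂μ|}
            ≤ 2 * Real.exp (-((k : ℝ) * n * δ ^ 2 / (2 * B ^ 2))) := by
  -- No sign is assumed for `R` or `M`, hence the absolute values here and in `B`.
  obtain ⟨K, hK0, hK⟩ :=
    Whiteout.exists_norm_layer_sub_le hact (abs_nonneg R) (Fin.last L)
  -- The first term is the Lipschitz constant of one loss, the second gives Hoeffding's range `M ≤ 2
  -- * B`, and `1` makes `B` positive.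
  refine ⟨2 * √M * K + |M| / 2 + 1, by positivity, fun n k hn hk x y w b hw _ hM => ?_⟩
  set B : ℝ := 2 * √M * K + |M| / 2 + 1 with hBdef
  have hlip : ∀ i, ∀ e e' : Whiteout.Edge m → ℝ, ‖Whiteout.output act w b (x i) e
      - Whiteout.output act w b (x i) e'‖ ≤ K * ‖e - e'‖ := fun i =>
    hK w b (x i) fun l j k' => (hw l j k').trans (le_abs_self R)
  have hB : 0 < B := by positivity
  have hKB : 2 * √M * K ≤ B := by rw [hBdef]; linarith [abs_nonneg M]
  have hMB : M ≤ 2 * B := by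
    have : 0 ≤ 2 * √M * K := by positivity
    rw [hBdef]; linarith [le_abs_self M]
  have : Nonempty (Fin n × Fin k) := ⟨(⟨0, hn⟩, ⟨0, hk⟩)⟩
  have hkn : (0 : ℝ) < k * n := by positivity
  have hcard : (Fintype.card (Fin n × Fin k) : ℝ) = k * n := by simp [mul_comm]
  refine ⟨LipschitzWith.of_dist_le_mul fun e e' => ?_, fun {Ω} _ μ _ e he => ?_⟩
  · rw [Real.coe_toNNReal _ (by positivity), Real.dist_eq, dist_eq_norm, Whiteout.pelf_eq_mean,
      Whiteout.pelf_eq_mean, ← mul_sub, ← Finset.sum_sub_distrib, abs_mul, hcard,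
      abs_of_pos (inv_pos.2 hkn)]
    have hterm : ∀ p : Fin n × Fin k,
        |‖Whiteout.output act w b (x p.1) (fun a => e (p.1, p.2, a)) - y p.1‖ ^ 2
          - ‖Whiteout.output act w b (x p.1) (fun a => e' (p.1, p.2, a)) - y p.1‖ ^ 2|
        ≤ B * ‖fun a : Whiteout.Edge m => (e - e') (p.1, p.2, a)‖ := by
      intro p
      refine (Whiteout.abs_norm_sub_sq_sub_le (hM _ _) (hM _ _)).trans ?_
      refine (mul_le_mul_of_nonneg_left (hlip _ _ _) (by positivity)).trans ?_
      rw [← mul_assoc]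
      exact mul_le_mul_of_nonneg_right hKB (norm_nonneg _)
    calc _ ≤ ((k : ℝ) * n)⁻¹ * (B * (√((k : ℝ) * n) * ‖e - e'‖)) := by
          refine mul_le_mul_of_nonneg_left ?_ (by positivity)
          refine (Finset.abs_sum_le_sum_abs _ _).trans
            ((Finset.sum_le_sum fun p _ => hterm p).trans ?_)
          rw [← Finset.mul_sum]
          exact mul_le_mul_of_nonneg_left (Whiteout.sum_norm_block_le _) hB.le
      _ = _ := by
          rw [div_eq_mul_inv, ← Real.sqrt_div_self]
          ring
  · have hae : ∀ (p : Fin n × Fin k) (a : Whiteout.Edge m),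
        AEMeasurable (fun ω => e ω (p.1, p.2, a)) μ := fun p a => (he.law p.1 p.2 a).aemeasurable
    have hrows : iIndepFun (fun (p : Fin n × Fin k) ω (a : Whiteout.Edge m) =>
        e ω (p.1, p.2, a)) μ :=
      Whiteout.iIndepFun_curry hae (he.indep.precomp (Equiv.prodAssoc _ _ _).injective)
    let loss : Fin n × Fin k → (Whiteout.Edge m → ℝ) → ℝ := fun p v =>
      ‖Whiteout.output act w b (x p.1) v - y p.1‖ ^ 2
    have hloss : ∀ p, Measurable (loss p) := fun p => by
      -- Measurability of the loss comes from the Lipschitz bound in the noise.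
      have : Continuous (Whiteout.output act w b (x p.1)) :=
        (LipschitzWith.of_dist_le_mul (K := ⟨K, hK0⟩) fun v v' => by
          rw [dist_eq_norm, dist_eq_norm]; exact hlip p.1 v v').continuous
      exact ((this.sub continuous_const).norm.pow 2).measurable
    let Z : Fin n × Fin k → Ω → ℝ := fun p ω => loss p fun a => e ω (p.1, p.2, a)
    have hZ : ∀ p, AEMeasurable (Z p) μ := fun p =>
      (hloss p).comp_aemeasurable (aemeasurable_pi_iff.2 (hae p))
    have hZB : ∀ p ω, Z p ω ∈ Set.Icc 0 (2 * B) := fun p ω =>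
      ⟨sq_nonneg _, (hM _ _).trans hMB⟩
    have hpelf : ∀ ω, Whiteout.pelf act w b k x y (e ω)
        = (Fintype.card (Fin n × Fin k) : ℝ)⁻¹ * ∑ p, Z p ω :=
      fun ω => Whiteout.pelf_eq_mean act w b x y (e ω)
    simp_rw [hpelf]
    refine ⟨(integrable_finsetSum _ fun p _ =>
      Integrable.of_mem_Icc 0 (2 * B) (hZ p) (.of_forall (hZB p))).const_mul _, fun δ hδ => ?_⟩
    rw [← hcard]
    exact Whiteout.measureReal_lt_abs_mean_sub_le hB hZ hZB (hrows.comp loss hloss) hδ
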